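/- Let $q\ge 2$ and let $X$ be the vertex set of a $q$-homogeneous tree, i.e. a tree in which every vertex has exactly $q+1$ neighbours, with its natural distance $d$. Let $\Omega$ be its boundary, the set of infinite chains (sequences $(x_i)_{i\in\mathbb N}$ with $d(x_i,x_{i+1})=1$ and $x_i\ne x_{i+2}$) modulo eventual equality up to a shift of the index, with the topology generated by the sets $\{\omega: u\in[v,\omega)\}$, where $[v,\omega)$ is the unique chain in the class $\omega$ starting at $v$. For $v\in X$ let $\nu^v$ be the probability measure on $\Omega$ invariant under the isometries of $X$ fixing $v$. For $\omega\in\Omega$ and $v,u\in X$ let $\kappa_\omega(v,u)\in\mathbb Z$ be the number of steps $[x,y]$ of the path from $v$ to $u$ with $y\in[x,\omega)$, minus the number of the other steps. Let $\Xi$ be the set of horocycles $h^v_{\omega,n}=\{x\in X:\kappa_\omega(v,x)=n\}$ ($\omega\in\Omega$, $v\in X$, $n\in\mathbb Z$), put $\Psi_v(\omega,n)=h^v_{\omega,n}$, and endow $\Xi$ with the measure $\lambda=(\Psi_v)_*(\nu^v\otimes q^n\,dn)$ ($dn$ the counting measure on $\mathbb Z$), which does not depend on $v$. Let $\mathbb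 T=\mathbb R/T\mathbb Z$ with $T=2\pi/\log q$, with normalized Lebesgue measure $dt$, and let $L^2_v(\Omega\times\mathbb T)$ be the $L^2$ space of $\nu^v\otimes dt$. For $F\in L^2(\Xi)=L^2(\Xi,\lambda)$ put $$\Phi_vF(\omega,t)=\sum_{n\in\mathbb Z}q^{n/2}F(h^v_{\omega,n})\,q^{int},$$ where the series converges in $L^2_v(\Omega\times\mathbb T)$. Let $L^2_\flat(\Xi)$ be the set of all $F\in L^2(\Xi)$ such that, for every $v\in X$ and almost every $t\in\mathbb T$, $$\int_\Omega\Phi_vF(\omega,t)\,d\nu^v(\omega)=\int_\Omega\Phi_vF(\omega,-t)\,d\nu^v(\omega).$$ For a finitely supported $f:X\to\mathbb C$, let $\mathcal Rf(\xi)=\sum_{x\in\xi}f(x)$, $\xi\in\Xi$, be its horocyclic Radon transform and, for $v\in X$, let $$\mathcal H_vf(\omega,t)=\sum_{x\in X}f(x)\,q^{(\frac12+it)\kappa_\omega(v,x)},\qquad(\omega,t)\in\Omega\times\mathbb T,$$ be its Helgason–Fourier transform. Then, for every finitely supported $f:X\to\mathbb C$, $\mathcal Rf\in L^2(\Xi)$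 and, for every $v\in X$, $\mathcal H_vf\in L^2_v(\Omega\times\mathbb T)$ and $$\Phi_v(\mathcal Rf)=\mathcal H_vf\quad\text{in }L^2_v(\Omega\times\mathbb T).$$ Moreover, $\mathcal Rf\in L^2_\flat(\Xi)$. -/

import Mathlib

open MeasureTheory ProbabilityTheory
open scoped ENNReal

/-- A `q`-homogeneous tree with vertex set `X`. -/
structure HomogeneousTree (X : Type*) (q : ℕ) where
  graph : SimpleGraph X
  isTree : graph.IsTree
  degree_eq : ∀ x, (graph.neighborSet x).ncard = q + 1

namespace HomogeneousTree

variable {X : Type*} {q : ℕ} (T : HomogeneousTree X q)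

/-- The natural distance on the vertices. -/
noncomputable def d (u v : X) : ℕ := T.graph.dist u v

theorem d_comm (u v : X) : T.d u v = T.d v u := SimpleGraph.dist_comm

theorem d_self (v : X) : T.d v v = 0 := SimpleGraph.dist_self

theorem d_eq_zero {u v : X} : T.d u v = 0 ↔ u = v := T.isTree.1.dist_eq_zero_iff

theorem d_eq_one {u v : X} : T.d u v = 1 ↔ T.graph.Adj u v := SimpleGraph.dist_eq_one_iff_adj

theorem d_adj (v : X) {x y : X} (h : T.graph.Adj x y) :
    T.d v x = T.d v y + 1 ∨ T.d v y = T.d v x + 1 :=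
  T.isTree.dist_eq_dist_add_one_of_adj v h

theorem exists_parent {v x : X} (h : x ≠ v) :
    ∃ y, T.graph.Adj y x ∧ T.d v x = T.d v y + 1 := by
  obtain ⟨p, hp, hl⟩ := T.isTree.1.exists_path_of_dist x v
  cases p with
  | nil => exact absurd rfl h
  | @cons _ y _ ha p =>
    refine ⟨y, ha.symm, ?_⟩
    have h1 : T.graph.dist y v ≤ p.length := SimpleGraph.dist_le p
    rw [SimpleGraph.Walk.length_cons] at hl
    rcases T.d_adj v ha with h2 | h2
    · exact h2
    · rw [d_comm, T.d_comm v x] at h2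
      unfold d at h2
      omega

theorem parent_unique {v x y z : X} (hy : T.graph.Adj y x) (hz : T.graph.Adj z x)
    (h1 : T.d v x = T.d v y + 1) (h2 : T.d v x = T.d v z + 1) : y = z := by
  have key : ∀ w, T.graph.Adj w x → T.d v x = T.d v w + 1 →
      ∃ p : T.graph.Walk x v, p.IsPath ∧ p.snd = w := by
    intro w hw h
    obtain ⟨p, hp, hl⟩ := T.isTree.1.exists_path_of_dist w v
    refine ⟨SimpleGraph.Walk.cons hw.symm p, ?_, by simp⟩
    apply SimpleGraph.Walk.isPath_of_length_eq_dist
    rw [SimpleGraph.Walk.length_cons, hl]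
    rw [d_comm, T.d_comm v w] at h
    exact h.symm
  obtain ⟨p, hp, rfl⟩ := key y hy h1
  obtain ⟨p', hp', rfl⟩ := key z hz h2
  rw [(T.isTree.existsUnique_path x v).unique hp hp']

/-- Infinite chains: `d (x i) (x (i+1)) = 1` and `x i ≠ x (i+2)` for all `i`. -/
abbrev Chain : Type _ :=
  {c : ℕ → X // ∀ i, T.d (c i) (c (i + 1)) = 1 ∧ c i ≠ c (i + 2)}

/-- Two chains are equivalent if they agree eventually, up to a shift of the index:
`x (a + i) = y (b + i)` for all `i`, for some `a` and `b`. -/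
instance chainSetoid : Setoid T.Chain where
  r x y := ∃ a b : ℕ, ∀ i, x.1 (a + i) = y.1 (b + i)
  iseqv :=
    { refl := fun _ => ⟨0, 0, fun _ => rfl⟩
      symm := fun ⟨a, b, h⟩ => ⟨b, a, fun i => (h i).symm⟩
      trans := by
        rintro x y z ⟨a, b, h⟩ ⟨a', b', h'⟩
        refine ⟨a + a', b' + b, fun i => ?_⟩
        have h1 := h (a' + i)
        have h2 := h' (b + i)
        rw [show a + a' + i = a + (a' + i) by omega, h1,
          show b + (a' + i) = a' + (b + i) by omega, h2, add_assoc] }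

/-- The boundary of the tree. -/
def Boundary : Type _ := Quotient T.chainSetoid

variable {T} in
/-- The boundary point at which a chain points. -/
def Chain.toBoundary (c : T.Chain) : T.Boundary := Quotient.mk _ c

/-- The boundary points `ω` such that `u ∈ [v, ω)`. -/
def shadow (v u : X) : Set T.Boundary :=
  {ω | ∃ c : T.Chain, c.toBoundary = ω ∧ c.1 0 = v ∧ ∃ i, c.1 i = u}

/-- The topology generated by the sets `{ω | u ∈ [v, ω)}`; since it does not depend on the
reference vertex, all reference vertices are used at once. -/
instance : TopologicalSpace T.Boundary :=
  TopologicalSpace.generateFrom {s | ∃ v u, s = T.shadow v u}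

instance : MeasurableSpace T.Boundary := borel _

instance : BorelSpace T.Boundary := ⟨rfl⟩

/-- The neighbours of `x` that are farther from `v` than `x`. -/
def Child (v x : X) : Type _ := {y : X // T.graph.Adj x y ∧ T.d v y = T.d v x + 1}

instance (v x : X) : MeasurableSpace (T.Child v x) := ⊤

instance (v x : X) : DiscreteMeasurableSpace (T.Child v x) := ⟨fun _ => trivial⟩

theorem ncard_child_self (v : X) : Nat.card (T.Child v v) = q + 1 := by
  rw [← T.degree_eq v]
  show Nat.card {y : X | T.graph.Adj v y ∧ T.d v y = T.d v v + 1} = _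
  rw [Nat.card_coe_set_eq]
  congr 1
  ext y
  simp only [Set.mem_ofPred_eq, SimpleGraph.mem_neighborSet, d_self, zero_add, d_eq_one, and_self]

theorem ncard_child {v x : X} (h : x ≠ v) : Nat.card (T.Child v x) = q := by
  obtain ⟨y, hy, hd⟩ := T.exists_parent h
  have h0 := T.degree_eq x
  have : {y : X | T.graph.Adj x y ∧ T.d v y = T.d v x + 1} = T.graph.neighborSet x \ {y} := by
    ext z
    simp only [Set.mem_ofPred_eq, Set.mem_sdiff, SimpleGraph.mem_neighborSet, Set.mem_singleton_iff]
    refine and_congr_right fun hz => ⟨?_, fun hne => ?_⟩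
    · rintro h rfl
      omega
    · rcases T.d_adj v hz with h1 | h1
      · exact absurd (T.parent_unique hz.symm hy h1 hd) hne
      · exact h1
  show Nat.card {y : X | T.graph.Adj x y ∧ T.d v y = T.d v x + 1} = _
  rw [Nat.card_coe_set_eq, this, Set.ncard_sdiff_singleton_of_mem (by exact hy.symm), h0]
  omega

theorem child_card_ne_zero [hq : Fact (2 ≤ q)] (v x : X) : Nat.card (T.Child v x) ≠ 0 := by
  by_cases h : x = v
  · subst h
    rw [ncard_child_self]
    omega
  · rw [T.ncard_child h]
    have := hq.out
    omega

instance [Fact (2 ≤ q)] (v x : X) : Nonempty (T.Child v x) :=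
  (Nat.card_ne_zero.1 (T.child_card_ne_zero v x)).1

instance [Fact (2 ≤ q)] (v x : X) : Finite (T.Child v x) :=
  (Nat.card_ne_zero.1 (T.child_card_ne_zero v x)).2

/-- Follow, from `v`, a choice of a farther neighbour at every vertex. -/
def follow (v : X) (s : ∀ x, T.Child v x) : ℕ → X
  | 0 => v
  | n + 1 => (s (follow v s n)).1

theorem d_follow (v : X) (s : ∀ x, T.Child v x) (n : ℕ) : T.d v (T.follow v s n) = n := by
  induction n with
  | zero => exact T.d_self v
  | succ n ih => rw [follow, (s _).2.2, ih]

/-- The infinite chain from `v` that a choice of farther neighbours determines. -/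
def followChain (v : X) (s : ∀ x, T.Child v x) : T.Chain :=
  ⟨T.follow v s, fun i => ⟨T.d_eq_one.2 (s _).2.1, fun h => by
    have h1 := congrArg (T.d v) h
    rw [d_follow, d_follow] at h1
    omega⟩⟩

/-- The law of the end point of the chain that starts at `v` and steps, at every vertex, to a
uniformly chosen neighbour farther from `v`. This is the probability measure `ν^v` on the boundary
that is invariant under the isometries fixing `v`: see `map_boundaryMeasure` and
`boundaryMeasure_shadow` below. -/
noncomputable def boundaryMeasure (v : X) : Measure T.Boundary :=
  (Measure.infinitePi fun x => uniformOn (Set.univ : Set (T.Child v x))).map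
    fun s => (T.followChain v s).toBoundary

section aux

variable {T}

theorem Chain.adj (c : T.Chain) (i : ℕ) : T.graph.Adj (c.1 i) (c.1 (i + 1)) :=
  T.d_eq_one.1 (c.2 i).1

theorem Chain.d_add (c : T.Chain) {v : X} {i : ℕ} (h : T.d v (c.1 (i + 1)) = T.d v (c.1 i) + 1)
    (k : ℕ) : T.d v (c.1 (i + k)) = T.d v (c.1 i) + k := by
  suffices ∀ k, T.d v (c.1 (i + k + 1)) = T.d v (c.1 (i + k)) + 1 by
    induction k with
    | zero => rfl
    | succ k ih => rw [← add_assoc, this, ih, add_assoc]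
  intro k
  induction k with
  | zero => exact h
  | succ k ih =>
    rcases T.d_adj v (c.adj (i + k + 1)) with h1 | h1
    · exact absurd (T.parent_unique (c.adj (i + k)) (c.adj (i + k + 1)).symm ih h1)
        (c.2 (i + k)).2
    · exact h1

theorem Chain.d_start (c : T.Chain) (n : ℕ) : T.d (c.1 0) (c.1 n) = n := by
  have h := c.d_add (v := c.1 0) (i := 0) (by rw [d_self, zero_add]; exact (c.2 0).1) n
  rwa [d_self, zero_add] at h

/-- Prepend a vertex to a chain. -/
def Chain.cons (c : T.Chain) (x : X) (h : T.graph.Adj x (c.1 0)) (hne : x ≠ c.1 1) : T.Chain :=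
  ⟨fun n => Nat.casesOn n x c.1, fun i => by
    cases i with
    | zero => exact ⟨T.d_eq_one.2 h, hne⟩
    | succ i => exact c.2 i⟩

theorem Chain.toBoundary_cons (c : T.Chain) (x : X) (h : T.graph.Adj x (c.1 0))
    (hne : x ≠ c.1 1) : (c.cons x h hne).toBoundary = c.toBoundary :=
  Quotient.sound ⟨1, 0, fun i => by rw [add_comm, zero_add]; rfl⟩

/-- Drop the first vertices of a chain. -/
def Chain.drop (c : T.Chain) (k : ℕ) : T.Chain := ⟨fun n => c.1 (k + n), fun i => c.2 (k + i)⟩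

theorem Chain.toBoundary_drop (c : T.Chain) (k : ℕ) : (c.drop k).toBoundary = c.toBoundary :=
  Quotient.sound ⟨0, k, fun i => by rw [zero_add]; rfl⟩

theorem exists_chain (v : X) (ω : T.Boundary) : ∃ c : T.Chain, c.toBoundary = ω ∧ c.1 0 = v := by
  obtain ⟨c, rfl⟩ := Quotient.exists_rep ω
  obtain ⟨p⟩ := T.isTree.1 v (c.1 0)
  suffices ∀ (u w : X), T.graph.Walk u w → ∀ ω : T.Boundary,
      (∃ c : T.Chain, c.toBoundary = ω ∧ c.1 0 = w) →
      ∃ c : T.Chain, c.toBoundary = ω ∧ c.1 0 = u from this _ _ p _ ⟨c, rfl, rfl⟩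
  intro u w p ω h
  induction p with
  | nil => exact h
  | @cons x _ _ ha p ih =>
    obtain ⟨c, rfl, hc⟩ := ih h
    by_cases h1 : x = c.1 1
    · exact ⟨c.drop 1, c.toBoundary_drop 1, h1.symm⟩
    · exact ⟨c.cons x (hc ▸ ha) h1, c.toBoundary_cons _ _ _, rfl⟩

theorem Chain.eq_of_start_eq {c c' : T.Chain} (h0 : c.1 0 = c'.1 0)
    (h : c.toBoundary = c'.toBoundary) : c = c' := by
  obtain ⟨a, b, hab⟩ := Quotient.exact h
  have h1 := c.d_start a
  have h2 := c'.d_start b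
  have h3 := hab 0
  rw [add_zero, add_zero] at h3
  rw [h3, h0, h2] at h1
  subst h1
  have key : ∀ n k, k + n = b → c.1 k = c'.1 k := by
    intro n
    induction n with
    | zero =>
      intro k hk
      rw [add_zero] at hk
      rw [hk]
      exact h3
    | succ n ih =>
      intro k hk
      have h4 := ih (k + 1) (by omega)
      refine T.parent_unique (v := c.1 0) (c.adj k) (h4 ▸ c'.adj k) ?_ ?_
      · rw [c.d_start, c.d_start]
      · rw [h4, h0, c'.d_start, c'.d_start]
  refine Subtype.ext (funext fun n => ?_)
  rcases le_total n b with hn | hn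
  · exact key (b - n) n (by omega)
  · have := hab (n - b)
    rwa [Nat.add_sub_cancel' hn] at this

theorem mem_shadow_iff (c : T.Chain) (u : X) :
    c.toBoundary ∈ T.shadow (c.1 0) u ↔ c.1 (T.d (c.1 0) u) = u := by
  constructor
  · rintro ⟨c', h, h0, i, rfl⟩
    obtain rfl := Chain.eq_of_start_eq h0 h
    rw [c'.d_start]
  · intro h
    exact ⟨c, rfl, rfl, _, h⟩

theorem mem_shadow_iff' {c : T.Chain} {v : X} (h : c.1 0 = v) (u : X) :
    c.toBoundary ∈ T.shadow v u ↔ c.1 (T.d v u) = u := by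
  subst h
  exact mem_shadow_iff c u

/-- Replace the tail of a chain. -/
theorem Chain.splice (c e : T.Chain) (k : ℕ) (h0 : e.1 0 = c.1 (k + 1)) (h1 : e.1 1 ≠ c.1 k) :
    ∃ f : T.Chain, f.toBoundary = e.toBoundary ∧ ∀ i ≤ k + 1, f.1 i = c.1 i := by
  have key : ∀ j ≤ k, ∃ f : T.Chain, f.toBoundary = e.toBoundary ∧
      ∀ i ≤ j + 1, f.1 i = c.1 (k - j + i) := by
    intro j
    induction j with
    | zero =>
      intro _
      refine ⟨e.cons (c.1 k) (h0 ▸ c.adj k) h1.symm, e.toBoundary_cons _ _ _, ?_⟩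
      intro i hi
      obtain rfl | rfl : i = 0 ∨ i = 1 := by omega
      · rfl
      · exact h0
    | succ j ih =>
      intro hj
      obtain ⟨f, hf, hi⟩ := ih (by omega)
      have e0 := hi 0 (by omega)
      have e1 := hi 1 (by omega)
      have hk : k - j = k - (j + 1) + 1 := by omega
      rw [hk] at e0 e1 hi
      refine ⟨f.cons (c.1 (k - (j + 1))) (e0 ▸ c.adj _) (e1 ▸ (c.2 _).2), ?_, ?_⟩
      · rw [f.toBoundary_cons, hf]
      · intro i h
        cases i with
        | zero => rfl
        | succ i =>
          show f.1 i = _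
          rw [hi i (by omega), show k - (j + 1) + 1 + i = k - (j + 1) + (i + 1) by omega]
  obtain ⟨f, hf, h⟩ := key k le_rfl
  refine ⟨f, hf, fun i hi => ?_⟩
  rw [h i hi, Nat.sub_self, zero_add]

theorem shadow_anti {v u w : X} {c : T.Chain} (h0 : c.1 0 = v) {i j : ℕ} (hij : i ≤ j)
    (hu : c.1 i = u) (hw : c.1 j = w) : T.shadow v w ⊆ T.shadow v u := by
  subst h0
  rintro _ ⟨e, rfl, he, m, rfl⟩
  refine ⟨e, rfl, he, i, ?_⟩
  have h1 := c.d_start j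
  rw [hw, ← he, e.d_start] at h1
  subst h1
  rw [← hu]
  have key : ∀ n k, k + n = m → e.1 k = c.1 k := by
    intro n
    induction n with
    | zero =>
      intro k hk
      rw [add_zero] at hk
      rw [hk, hw]
    | succ n ih =>
      intro k hk
      have h4 := ih (k + 1) (by omega)
      refine T.parent_unique (v := e.1 0) (e.adj k) (h4 ▸ c.adj k) ?_ ?_
      · rw [e.d_start, e.d_start]
      · rw [h4, he, c.d_start, c.d_start]
  exact key (m - i) i (by omega)

theorem exists_shadow_subset (v : X) {v' u : X} {ω : T.Boundary} (h : ω ∈ T.shadow v' u) :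
    ∃ w, ω ∈ T.shadow v w ∧ T.shadow v w ⊆ T.shadow v' u := by
  obtain ⟨c, rfl, rfl, j, rfl⟩ := h
  obtain ⟨r, hr, rfl⟩ := T.exists_chain v c.toBoundary
  obtain ⟨a, b, hab⟩ := Quotient.exact hr
  refine ⟨r.1 (a + j + 1), ⟨r, hr, rfl, _, rfl⟩, ?_⟩
  rintro _ ⟨r', rfl, h0, m, hm⟩
  have hm' : m = a + j + 1 := by
    have h1 := r'.d_start m
    rwa [hm, h0, r.d_start, eq_comm] at h1
  subst hm'
  have hj1 := hab (j + 1)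
  have hj := hab j
  rw [← add_assoc, ← add_assoc] at hj1
  obtain ⟨f, hf, hfi⟩ := c.splice (r'.drop (a + j + 1)) (b + j) (hm.trans hj1) (by
    intro h
    have h1 : r'.1 (a + j + 1 + 1) = r.1 (a + j) := h.trans hj.symm
    have h2 := congrArg (T.d (r.1 0)) h1
    rw [r.d_start, ← h0, r'.d_start] at h2
    omega)
  rw [← r'.toBoundary_drop (a + j + 1), ← hf]
  exact ⟨f, rfl, hfi 0 (by omega), j, hfi j (by omega)⟩

theorem finite_sphere (v : X) (n : ℕ) : {x | T.d v x = n}.Finite := by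
  induction n with
  | zero =>
    refine (Set.finite_singleton v).subset fun x hx => ?_
    exact (T.d_eq_zero.1 hx).symm
  | succ n ih =>
    have : {x | T.d v x = n + 1} ⊆ ⋃ y ∈ {x | T.d v x = n}, T.graph.neighborSet y := by
      intro x hx
      have hx' : T.d v x = n + 1 := hx
      obtain ⟨y, hy, hd⟩ := T.exists_parent (v := v) (x := x) (by
        rintro rfl
        rw [d_self] at hx'
        omega)
      refine Set.mem_biUnion (x := y) ?_ hy
      show T.d v y = n
      omega
    refine (ih.biUnion fun y _ => ?_).subset this
    exact Set.finite_of_ncard_ne_zero (by rw [T.degree_eq]; omega)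

theorem countable_vertices (T : HomogeneousTree X q) : Countable X := by
  obtain ⟨v⟩ := T.isTree.1.nonempty
  have : (Set.univ : Set X) = ⋃ n, {x | T.d v x = n} := by
    ext x
    simp
  rw [← Set.countable_univ_iff, this]
  exact Set.countable_iUnion fun n => (T.finite_sphere v n).countable

theorem isOpen_shadow (v u : X) : IsOpen (T.shadow v u) :=
  TopologicalSpace.isOpen_generateFrom_of_mem ⟨v, u, rfl⟩

theorem measurableSet_shadow (v u : X) : MeasurableSet (T.shadow v u) :=
  (isOpen_shadow v u).measurableSet

instance : SecondCountableTopology T.Boundary := by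
  have := T.countable_vertices
  refine ⟨⟨{s | ∃ v u, s = T.shadow v u}, ?_, rfl⟩⟩
  refine (Set.countable_range fun p : X × X => T.shadow p.1 p.2).mono ?_
  rintro _ ⟨v, u, rfl⟩
  exact ⟨(v, u), rfl⟩

theorem measurableSpace_eq (v : X) : (inferInstance : MeasurableSpace T.Boundary) =
    MeasurableSpace.generateFrom (Set.range (T.shadow v)) := by
  have := T.countable_vertices
  apply le_antisymm
  · have h : borel T.Boundary = MeasurableSpace.generateFrom {s | ∃ v u, s = T.shadow v u} :=
      borel_eq_generateFrom_of_subbasis rfl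
    show borel _ ≤ _
    rw [h]
    refine MeasurableSpace.generateFrom_le ?_
    rintro _ ⟨v', u, rfl⟩
    have : T.shadow v' u = ⋃ w ∈ {w | T.shadow v w ⊆ T.shadow v' u}, T.shadow v w := by
      apply Set.Subset.antisymm
      · intro ω hω
        obtain ⟨w, h1, h2⟩ := exists_shadow_subset v hω
        exact Set.mem_biUnion (x := w) h2 h1
      · exact Set.iUnion₂_subset fun w hw => hw
    rw [this]
    refine MeasurableSet.biUnion (Set.to_countable _) fun w _ => ?_
    exact MeasurableSpace.measurableSet_generateFrom ⟨w, rfl⟩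
  · refine MeasurableSpace.generateFrom_le ?_
    rintro _ ⟨u, rfl⟩
    exact measurableSet_shadow v u

theorem measurable_of_shadow {α : Type*} [MeasurableSpace α] (v : X) {f : α → T.Boundary}
    (h : ∀ u, MeasurableSet (f ⁻¹' T.shadow v u)) : Measurable f := by
  have key : @Measurable _ _ _ (MeasurableSpace.generateFrom (Set.range (T.shadow v))) f := by
    refine measurable_generateFrom ?_
    rintro _ ⟨u, rfl⟩
    exact h u
  rwa [← measurableSpace_eq v] at key

theorem isPiSystem_shadow (v : X) : IsPiSystem (Set.range (T.shadow v)) := by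
  rintro _ ⟨u, rfl⟩ _ ⟨w, rfl⟩ ⟨ω, ⟨c, rfl, h0, i, hi⟩, h2⟩
  rw [mem_shadow_iff' h0] at h2
  rcases le_total i (T.d v w) with h | h
  · rw [Set.inter_eq_right.2 (shadow_anti h0 h hi h2)]
    exact ⟨w, rfl⟩
  · rw [Set.inter_eq_left.2 (shadow_anti h0 h h2 hi)]
    exact ⟨u, rfl⟩

theorem measure_ext (v : X) {μ ν : Measure T.Boundary} [IsFiniteMeasure μ]
    (h : ∀ u, μ (T.shadow v u) = ν (T.shadow v u)) : μ = ν := by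
  refine ext_of_generate_finite _ (measurableSpace_eq v) (isPiSystem_shadow v) ?_ ?_
  · rintro _ ⟨u, rfl⟩
    exact h u
  · have : T.shadow v v = Set.univ := by
      refine Set.eq_univ_of_forall fun ω => ?_
      obtain ⟨c, rfl, h0⟩ := exists_chain v ω
      exact ⟨c, rfl, h0, 0, h0⟩
    rw [← this]
    exact h v

end aux

section measure

variable {T} in
theorem follow_preimage (v u : X) :
    (fun s => (T.followChain v s).toBoundary) ⁻¹' T.shadow v u =
      {s | T.follow v s (T.d v u) = u} := by
  ext s
  exact mem_shadow_iff' (c := T.followChain v s) rfl u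

/-- The action on the boundary of a bijection of the vertices that preserves the distance. -/
def boundaryMap (g : X ≃ X) (hg : ∀ x y, T.d (g x) (g y) = T.d x y) : T.Boundary → T.Boundary :=
  Quotient.map
    (fun c : T.Chain => ⟨fun i => g (c.1 i), fun i =>
      ⟨(hg _ _).trans (c.2 i).1, fun h => (c.2 i).2 (g.injective h)⟩⟩)
    (by
      rintro c e ⟨a, b, h⟩
      exact ⟨a, b, fun i => congrArg g (h i)⟩)

theorem boundaryMap_preimage (g : X ≃ X) (hg : ∀ x y, T.d (g x) (g y) = T.d x y) (v u : X) :
    T.boundaryMap g hg ⁻¹' T.shadow (g v) (g u) = T.shadow v u := by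
  ext ω
  obtain ⟨c, rfl, rfl⟩ := exists_chain v ω
  rw [mem_shadow_iff, Set.mem_preimage]
  refine Iff.trans (mem_shadow_iff' (c := ⟨fun i => g (c.1 i), fun i =>
      ⟨(hg _ _).trans (c.2 i).1, fun h => (c.2 i).2 (g.injective h)⟩⟩) rfl (g u)) ?_
  rw [hg]
  exact g.injective.eq_iff

variable [hq : Fact (2 ≤ q)]

open Classical in
variable {T} in
theorem follow_cylinder (v u : X) : ∃ (I : Finset X) (t : ∀ x, Set (T.Child v x)),
    (∀ x ∈ I, T.d v x < T.d v u) ∧ {s | T.follow v s (T.d v u) = u} = Set.pi I t ∧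
    ∏ x ∈ I, uniformOn (Set.univ : Set (T.Child v x)) (t x) =
      if u = v then 1 else ((q + 1 : ℝ≥0∞) * q ^ (T.d v u - 1))⁻¹ := by
  obtain ⟨n, hn⟩ : ∃ n, n = T.d v u := ⟨_, rfl⟩
  rw [← hn]
  induction n generalizing u with
  | zero =>
    obtain rfl := T.d_eq_zero.1 hn.symm
    refine ⟨∅, fun _ => Set.univ, by simp, ?_, by simp⟩
    ext s
    simp [follow]
  | succ n ih =>
    have huv : u ≠ v := by
      rintro rfl
      rw [d_self] at hn
      omega
    obtain ⟨y, hy, hd⟩ := T.exists_parent huv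
    have hyn : n = T.d v y := by omega
    obtain ⟨I, t, hI, hset, hprod⟩ := ih y hyn
    obtain ⟨a, ha⟩ : ∃ a : T.Child v y, a.1 = u := ⟨⟨u, hy, hd⟩, rfl⟩
    have hyI : y ∉ I := fun h => by
      have := hI y h
      omega
    refine ⟨insert y I, Function.update t y {a}, ?_, ?_, ?_⟩
    · intro x hx
      rcases Finset.mem_insert.1 hx with rfl | hx
      · omega
      · have := hI x hx
        omega
    · have h1 : ∀ s : ∀ x, T.Child v x, T.follow v s (n + 1) = u ↔
          T.follow v s n = y ∧ s y = a := by
        intro s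
        constructor
        · intro h
          have h2 : T.follow v s n = y := by
            refine T.parent_unique (v := v) (x := u) ?_ hy ?_ hd
            · rw [← h]
              exact (s _).2.1
            · rw [d_follow, ← hn]
          refine ⟨h2, Subtype.ext ?_⟩
          subst h2
          exact h.trans ha.symm
        · rintro ⟨rfl, h3⟩
          exact (congrArg Subtype.val h3).trans ha
      ext s
      rw [Set.mem_ofPred_eq, h1]
      have h2 : T.follow v s n = y ↔ s ∈ Set.pi I t := by
        rw [← hset]
        rfl
      rw [h2, Finset.coe_insert, Set.insert_pi]
      simp only [Function.update_self, Set.mem_inter_iff, Set.mem_preimage, Function.eval]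
      rw [and_comm]
      refine and_congr_right fun _ => ?_
      refine forall₂_congr fun x hx => ?_
      rw [Function.update_of_ne]
      rintro rfl
      exact hyI hx
    · rw [Finset.prod_insert hyI, if_neg huv, Function.update_self]
      have h3 : ∏ x ∈ I, uniformOn (Set.univ : Set (T.Child v x))
          (Function.update t y {a} x) =
          ∏ x ∈ I, uniformOn (Set.univ : Set (T.Child v x)) (t x) := by
        refine Finset.prod_congr rfl fun x hx => ?_
        rw [Function.update_of_ne]
        rintro rfl
        exact hyI hx
      rw [h3, hprod]
      have : Fintype (T.Child v y) := Fintype.ofFinite _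
      rw [uniformOn_univ, Measure.count_singleton, ← Nat.card_eq_fintype_card, one_div]
      by_cases hyv : y = v
      · subst hyv
        rw [d_self] at hyn
        subst hyn
        rw [ncard_child_self]
        simp
      · rw [T.ncard_child hyv, if_neg hyv]
        have hn0 : n ≠ 0 := fun h => hyv (T.d_eq_zero.1 (h ▸ hyn).symm).symm
        obtain ⟨m, rfl⟩ := Nat.exists_eq_succ_of_ne_zero hn0
        have hq0 : (q : ℝ≥0∞) ≠ 0 := by
          have := hq.out
          simp
          omega
        rw [← ENNReal.mul_inv (Or.inl hq0) (Or.inl (ENNReal.natCast_ne_top q))]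
        congr 1
        simp only [Nat.succ_eq_add_one, Nat.add_sub_cancel]
        rw [pow_succ]
        ring

variable {T} in
theorem measurable_follow (v : X) :
    Measurable fun s : ∀ x, T.Child v x => (T.followChain v s).toBoundary := by
  refine measurable_of_shadow v fun u => ?_
  rw [follow_preimage]
  obtain ⟨I, t, -, h, -⟩ := follow_cylinder (T := T) v u
  rw [h]
  exact MeasurableSet.pi I.countable_toSet fun _ _ => MeasurableSet.of_discrete

instance (v : X) : IsProbabilityMeasure (T.boundaryMeasure v) :=
  Measure.isProbabilityMeasure_map (measurable_follow v).aemeasurable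

/-- `ν^v {ω | u ∈ [v, ω)} = q / ((q + 1) q ^ d(v, u))` for `u ≠ v`. -/
theorem boundaryMeasure_shadow (v : X) {u : X} (h : u ≠ v) :
    T.boundaryMeasure v (T.shadow v u) = ((q + 1 : ℝ≥0∞) * q ^ (T.d v u - 1))⁻¹ := by
  rw [boundaryMeasure, Measure.map_apply (measurable_follow v) (measurableSet_shadow v u),
    follow_preimage]
  obtain ⟨I, t, -, h1, h2⟩ := follow_cylinder (T := T) v u
  rw [h1, Measure.infinitePi_pi _ (fun _ _ => MeasurableSet.of_discrete), h2, if_neg h]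


/-- `ν^v` is invariant under the isometries that fix `v`. -/
theorem map_boundaryMeasure (g : X ≃ X) (hg : ∀ x y, T.d (g x) (g y) = T.d x y) (v : X)
    (hv : g v = v) : (T.boundaryMeasure v).map (T.boundaryMap g hg) = T.boundaryMeasure v := by
  have hpre : ∀ u, T.boundaryMap g hg ⁻¹' T.shadow v u = T.shadow v (g.symm u) := by
    intro u
    have h := T.boundaryMap_preimage g hg v (g.symm u)
    rwa [hv, g.apply_symm_apply] at h
  have hm : Measurable (T.boundaryMap g hg) := by
    refine measurable_of_shadow v fun u => ?_
    rw [hpre]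
    exact measurableSet_shadow _ _
  have : IsProbabilityMeasure ((T.boundaryMeasure v).map (T.boundaryMap g hg)) :=
    Measure.isProbabilityMeasure_map hm.aemeasurable
  refine measure_ext v fun u => ?_
  rw [Measure.map_apply hm (measurableSet_shadow v u), hpre]
  by_cases h : u = v
  · subst h
    rw [show g.symm u = u by rw [Equiv.symm_apply_eq, hv]]
  · have h' : g.symm u ≠ v := fun h' => h (by rw [← hv, ← h', g.apply_symm_apply])
    rw [boundaryMeasure_shadow _ _ h, boundaryMeasure_shadow _ _ h', ← hg v (g.symm u), hv,
      g.apply_symm_apply]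

end measure

section horocycles

/-- The path `[v, u]`. -/
noncomputable def path (v u : X) : T.graph.Walk v u := (T.isTree.existsUnique_path v u).choose

open Classical in
/-- The horocyclic index `κ_ω(v, u)`: the number of the steps `[x, y]` of the path `[v, u]` with
`y ∈ [x, ω)` minus the number of the other steps. -/
noncomputable def horoIndex (ω : T.Boundary) (v u : X) : ℤ :=
  (((T.path v u).darts.map fun e => if ω ∈ T.shadow e.fst e.snd then (1 : ℤ) else -1)).sum

/-- The horocycle tangent to `ω` of index `n` with respect to `v`. -/
def horocycle (ω : T.Boundary) (v : X) (n : ℤ) : Set X := {x | T.horoIndex ω v x = n}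

/-- The set of horocycles. -/
def Horocycles : Type _ := {s : Set X // ∃ ω v n, s = T.horocycle ω v n}

/-- The parametrization `(ω, n) ↦ h_{ω,n}^v` of the horocycles. -/
def param (v : X) (p : T.Boundary × ℤ) : T.Horocycles := ⟨T.horocycle p.1 v p.2, p.1, v, p.2, rfl⟩

/-- The `σ`-algebra carried over from `Ω × ℤ` by the parametrizations; since it does not depend on
the reference vertex, all reference vertices are used at once. -/
instance : MeasurableSpace T.Horocycles :=
  ⨅ v, MeasurableSpace.map (T.param v) inferInstance

theorem measurable_param (v : X) : Measurable (T.param v) :=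
  measurable_iff_le_map.2 (iInf_le _ v)

theorem path_eq {v u : X} (p : T.graph.Walk v u) (hp : p.IsPath) : T.path v u = p :=
  (T.isTree.existsUnique_path v u).unique (T.isTree.existsUnique_path v u).choose_spec.1 hp

theorem path_isPath (v u : X) : (T.path v u).IsPath :=
  (T.isTree.existsUnique_path v u).choose_spec.1

theorem path_length (v u : X) : (T.path v u).length = T.d v u := by
  obtain ⟨p, hp, hl⟩ := T.isTree.1.exists_path_of_dist v u
  rw [T.path_eq p hp, hl]
  rfl

theorem horoIndex_self (ω : T.Boundary) (v : X) : T.horoIndex ω v v = 0 := by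
  rw [horoIndex, T.path_eq SimpleGraph.Walk.nil (by simp)]
  simp

open Classical in
theorem horoIndex_step (ω : T.Boundary) {v u x : X} (h : T.graph.Adj v u)
    (hd : T.d v x = T.d u x + 1) :
    T.horoIndex ω v x = (if ω ∈ T.shadow v u then 1 else -1) + T.horoIndex ω u x := by
  have : T.path v x = SimpleGraph.Walk.cons h (T.path u x) := by
    apply path_eq
    apply SimpleGraph.Walk.isPath_of_length_eq_dist
    rw [SimpleGraph.Walk.length_cons, path_length]
    exact hd.symm
  rw [horoIndex, this]
  simp [horoIndex]

open Classical in
theorem horoIndex_adj (ω : T.Boundary) {v u : X} (h : T.graph.Adj v u) :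
    T.horoIndex ω v u = if ω ∈ T.shadow v u then 1 else -1 := by
  rw [T.horoIndex_step ω h (by rw [d_self, T.d_eq_one.2 h]), horoIndex_self, add_zero]

theorem mem_shadow_adj {v u : X} (h : T.graph.Adj v u) (c : T.Chain) (h0 : c.1 0 = v) :
    c.toBoundary ∈ T.shadow v u ↔ c.1 1 = u := by
  rw [mem_shadow_iff' h0, T.d_eq_one.2 h]

theorem shadow_adj_compl (ω : T.Boundary) {v u : X} (h : T.graph.Adj v u) :
    ω ∈ T.shadow u v ↔ ω ∉ T.shadow v u := by
  obtain ⟨c, rfl, h0⟩ := exists_chain v ω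
  rw [T.mem_shadow_adj h c h0]
  by_cases h1 : u = c.1 1
  · have h2 := T.mem_shadow_adj h.symm (c.drop 1) h1.symm
    rw [c.toBoundary_drop] at h2
    rw [h2]
    refine iff_of_false (fun h3 => (c.2 0).2 (h0.trans h3.symm)) (fun h3 => h3 h1.symm)
  · subst h0
    have h2 := T.mem_shadow_adj h.symm (c.cons u h.symm h1) rfl
    rw [c.toBoundary_cons] at h2
    rw [h2]
    exact iff_of_true rfl (fun h3 => h1 h3.symm)

theorem horoIndex_swap (ω : T.Boundary) {v u : X} (h : T.graph.Adj v u) :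
    T.horoIndex ω u v = - T.horoIndex ω v u := by
  classical
  rw [T.horoIndex_adj ω h, T.horoIndex_adj ω h.symm]
  by_cases h1 : ω ∈ T.shadow v u
  · rw [if_pos h1, if_neg (fun h2 => (T.shadow_adj_compl ω h).1 h2 h1)]
  · rw [if_neg h1, if_pos ((T.shadow_adj_compl ω h).2 h1), neg_neg]

theorem horoIndex_add_adj (ω : T.Boundary) {v u : X} (h : T.graph.Adj v u) (x : X) :
    T.horoIndex ω v x = T.horoIndex ω v u + T.horoIndex ω u x := by
  classical
  rcases T.d_adj x h with h1 | h1
  · rw [T.d_comm x v, T.d_comm x u] at h1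
    rw [T.horoIndex_step ω h h1, T.horoIndex_adj ω h]
  · rw [T.d_comm x v, T.d_comm x u] at h1
    rw [T.horoIndex_step ω h.symm h1, ← T.horoIndex_adj ω h.symm, T.horoIndex_swap ω h]
    ring

theorem param_adj {v u : X} (h : T.graph.Adj v u) (ω : T.Boundary) (n : ℤ) :
    T.param u (ω, n) = T.param v (ω, n + T.horoIndex ω v u) := by
  refine Subtype.ext (Set.ext fun x => ?_)
  show T.horoIndex ω u x = n ↔ T.horoIndex ω v x = n + T.horoIndex ω v u
  rw [T.horoIndex_add_adj ω h]
  omega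


theorem shadow_adj_subset {v u w : X} (h : T.graph.Adj v u) (hd : T.d v w = T.d u w + 1)
    {c : T.Chain} (h0 : c.1 0 = v) {m : ℕ} (hm : c.1 m = w) : c.1 1 = u ∧ m = T.d u w + 1 := by
  have h1 : T.d v w = m := by
    rw [← h0, ← hm, c.d_start]
  have h2 : m = T.d u w + 1 := h1.symm.trans hd
  refine ⟨?_, h2⟩
  have h3 := (c.drop 1).d_start (T.d u w)
  change T.d (c.1 (1 + 0)) (c.1 (1 + T.d u w)) = _ at h3
  rw [add_comm 1 (T.d u w), ← h2, hm, add_zero] at h3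
  refine T.parent_unique (v := w) (x := v) (h0 ▸ (c.adj 0).symm) h.symm ?_ ?_
  · rw [T.d_comm, T.d_comm w, h3, hd]
  · rw [T.d_comm, T.d_comm w, hd]

theorem shadow_subset {v u w : X} (h : T.graph.Adj v u) (hd : T.d v w = T.d u w + 1) :
    T.shadow v w ⊆ T.shadow v u := by
  rintro _ ⟨c, rfl, h0, m, hm⟩
  exact ⟨c, rfl, h0, 1, (T.shadow_adj_subset h hd h0 hm).1⟩

theorem shadow_eq {v u w : X} (h : T.graph.Adj v u) (hd : T.d v w = T.d u w + 1) (hw : w ≠ u) :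
    T.shadow v w = T.shadow u w := by
  ext ω
  constructor
  · rintro ⟨c, rfl, h0, m, hm⟩
    obtain ⟨h1, h2⟩ := T.shadow_adj_subset h hd h0 hm
    refine ⟨c.drop 1, c.toBoundary_drop 1, h1, T.d u w, ?_⟩
    show c.1 (1 + T.d u w) = w
    rw [add_comm, ← h2, hm]
  · rintro ⟨c, rfl, rfl, m, rfl⟩
    have hne : v ≠ c.1 1 := by
      rintro rfl
      cases m with
      | zero => exact hw rfl
      | succ m =>
        have h3 := (c.drop 1).d_start m
        change T.d (c.1 (1 + 0)) (c.1 (1 + m)) = _ at h3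
        rw [add_comm 1 m, add_zero] at h3
        rw [h3, c.d_start] at hd
        omega
    exact ⟨c.cons v h hne, c.toBoundary_cons _ _ _, rfl, m + 1, rfl⟩

theorem shadow_self (v : X) : T.shadow v v = Set.univ := by
  refine Set.eq_univ_of_forall fun ω => ?_
  obtain ⟨c, rfl, h0⟩ := exists_chain v ω
  exact ⟨c, rfl, h0, 0, h0⟩

theorem shadow_compl {v u : X} (h : T.graph.Adj v u) : (T.shadow u v)ᶜ = T.shadow v u := by
  ext ω
  rw [Set.mem_compl_iff, T.shadow_adj_compl ω h, not_not]

theorem one_sub_inv : (1 : ℝ≥0∞) - ((q : ℝ≥0∞) + 1)⁻¹ = q * ((q : ℝ≥0∞) + 1)⁻¹ := by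
  have h : (q : ℝ≥0∞) * ((q : ℝ≥0∞) + 1)⁻¹ + ((q : ℝ≥0∞) + 1)⁻¹ = 1 := by
    rw [← add_one_mul, ENNReal.mul_inv_cancel (by simp) (by finiteness)]
  calc (1 : ℝ≥0∞) - ((q : ℝ≥0∞) + 1)⁻¹
      = q * ((q : ℝ≥0∞) + 1)⁻¹ + ((q : ℝ≥0∞) + 1)⁻¹ - ((q : ℝ≥0∞) + 1)⁻¹ := by rw [h]
    _ = q * ((q : ℝ≥0∞) + 1)⁻¹ := ENNReal.add_sub_cancel_right (by simp)

/-- The measure on `ℤ` with density `q ^ n` with respect to the counting measure. -/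
noncomputable def weight (q : ℕ) : Measure ℤ :=
  Measure.count.withDensity fun n => (q : ℝ≥0∞) ^ n

instance : SFinite (weight q) := by
  unfold weight
  infer_instance

theorem weight_apply (s : Set ℤ) :
    weight q s = ∑' n, s.indicator (fun n => (q : ℝ≥0∞) ^ n) n := by
  rw [weight, withDensity_apply _ MeasurableSet.of_discrete, ← lintegral_indicator
    MeasurableSet.of_discrete, lintegral_count]

variable [hq : Fact (2 ≤ q)]

theorem q_ne_zero : (q : ℝ≥0∞) ≠ 0 := by
  have := hq.out
  simp
  omega

theorem boundaryMeasure_shadow_adj {v u w : X} (h : T.graph.Adj v u)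
    (hd : T.d v w = T.d u w + 1) :
    T.boundaryMeasure u (T.shadow v w) = q * T.boundaryMeasure v (T.shadow v w) := by
  have hwv : w ≠ v := by
    rintro rfl
    rw [d_self] at hd
    omega
  rw [boundaryMeasure_shadow _ _ hwv]
  by_cases hw : w = u
  · subst hw
    rw [← T.shadow_compl h, prob_compl_eq_one_sub (measurableSet_shadow _ _),
      boundaryMeasure_shadow _ _ hwv.symm, T.d_eq_one.2 h, T.d_eq_one.2 h.symm]
    simpa using one_sub_inv
  · rw [T.shadow_eq h hd hw, boundaryMeasure_shadow _ _ hw, hd]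
    obtain ⟨m, hm⟩ := Nat.exists_eq_succ_of_ne_zero (n := T.d u w)
      (fun h0 => hw (T.d_eq_zero.1 h0).symm)
    rw [hm]
    simp only [Nat.succ_eq_add_one, Nat.add_sub_cancel]
    rw [pow_succ, ← mul_assoc, ENNReal.mul_inv (Or.inr (by simp)) (Or.inr q_ne_zero),
      mul_left_comm, ENNReal.mul_inv_cancel q_ne_zero (by simp), mul_one]

open Classical in
/-- The density of `ν^u` with respect to `ν^v`, for adjacent `v` and `u`, is `q ^ κ_ω(v, u)`. -/
theorem boundaryMeasure_adj {v u : X} (h : T.graph.Adj v u) :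
    T.boundaryMeasure u = (T.boundaryMeasure v).withDensity
      fun ω => if ω ∈ T.shadow v u then (q : ℝ≥0∞) else (q : ℝ≥0∞)⁻¹ := by
  have hms := measurableSet_shadow (T := T) v u
  have key : ∀ w, w ≠ v → T.boundaryMeasure u (T.shadow v w) =
      ∫⁻ ω in T.shadow v w, (if ω ∈ T.shadow v u then (q : ℝ≥0∞) else (q : ℝ≥0∞)⁻¹)
        ∂T.boundaryMeasure v := by
    intro w hwv
    rcases T.d_adj w h with hd | hd
    · rw [T.d_comm w v, T.d_comm w u] at hd
      rw [setLIntegral_congr_fun (g := fun _ => (q : ℝ≥0∞)) (measurableSet_shadow _ _)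
        (fun ω hω => if_pos (T.shadow_subset h hd hω)), setLIntegral_const,
        T.boundaryMeasure_shadow_adj h hd]
    · rw [T.d_comm w v, T.d_comm w u] at hd
      have e := T.shadow_eq h.symm hd hwv
      rw [setLIntegral_congr_fun (g := fun _ => (q : ℝ≥0∞)⁻¹) (measurableSet_shadow _ _)
        (fun ω hω => if_neg (fun h' => (T.shadow_adj_compl ω h).1
          (T.shadow_subset h.symm hd (e ▸ hω)) h')), setLIntegral_const, ← e,
        T.boundaryMeasure_shadow_adj h.symm hd, ← mul_assoc,
        ENNReal.inv_mul_cancel q_ne_zero (by simp), one_mul]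
  refine measure_ext v fun w => ?_
  rw [withDensity_apply _ (measurableSet_shadow _ _)]
  by_cases hwv : w = v
  · subst hwv
    have h1 : T.shadow w w = T.shadow w u ∪ T.shadow u w := by
      rw [shadow_self, ← T.shadow_compl h, Set.compl_union_self]
    have h2 : Disjoint (T.shadow w u) (T.shadow u w) := by
      rw [← T.shadow_compl h]
      exact disjoint_compl_left
    rw [h1, measure_union h2 (measurableSet_shadow _ _),
      lintegral_union (measurableSet_shadow _ _) h2, key u h.ne']
    congr 1
    rw [setLIntegral_congr_fun (g := fun _ => (q : ℝ≥0∞)⁻¹) (measurableSet_shadow _ _)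
        (fun ω hω => if_neg ((T.shadow_adj_compl ω h).1 hω)), setLIntegral_const,
        T.boundaryMeasure_shadow_adj h.symm (by rw [d_self, T.d_eq_one.2 h.symm]), ← mul_assoc,
        ENNReal.inv_mul_cancel q_ne_zero (by simp), one_mul]
  · exact key w hwv

theorem weight_shift (s : Set ℤ) (k : ℤ) :
    (q : ℝ≥0∞) ^ k * weight q {n | n + k ∈ s} = weight q s := by
  rw [weight_apply, weight_apply, ← ENNReal.tsum_mul_left, 
    ← (Equiv.addRight k).tsum_eq (s.indicator fun n => (q : ℝ≥0∞) ^ n)]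
  refine tsum_congr fun n => ?_
  show (q : ℝ≥0∞) ^ k * Set.indicator {n | n + k ∈ s} (fun n => (q : ℝ≥0∞) ^ n) n =
    s.indicator (fun n => (q : ℝ≥0∞) ^ n) (n + k)
  by_cases h : n + k ∈ s
  · rw [Set.indicator_of_mem (show n ∈ {n | n + k ∈ s} from h), Set.indicator_of_mem h,
      ENNReal.zpow_add q_ne_zero (by simp), mul_comm]
  · rw [Set.indicator_of_notMem (show n ∉ {n | n + k ∈ s} from h), Set.indicator_of_notMem h,
      mul_zero]

/-- The push-forward of `ν^v ⊗ q ^ n dn` by the parametrization with respect to `v`. -/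
noncomputable def horoMeasureAt (v : X) : Measure T.Horocycles :=
  ((T.boundaryMeasure v).prod (weight q)).map (T.param v)

theorem horoMeasureAt_adj {v u : X} (h : T.graph.Adj v u) :
    T.horoMeasureAt u = T.horoMeasureAt v := by
  classical
  ext s hs
  have hu := T.measurable_param u hs
  have hv := T.measurable_param v hs
  have hm : Measurable fun ω : T.Boundary =>
      if ω ∈ T.shadow v u then (q : ℝ≥0∞) else (q : ℝ≥0∞)⁻¹ :=
    Measurable.ite (measurableSet_shadow v u) measurable_const measurable_const
  rw [horoMeasureAt, horoMeasureAt, Measure.map_apply (T.measurable_param u) hs,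
    Measure.map_apply (T.measurable_param v) hs, Measure.prod_apply hu, Measure.prod_apply hv,
    T.boundaryMeasure_adj h, lintegral_withDensity_eq_lintegral_mul _ hm
      (measurable_measure_prodMk_left hu)]
  refine lintegral_congr fun ω => ?_
  rw [Pi.mul_apply, ← weight_shift (Prod.mk ω ⁻¹' (T.param v ⁻¹' s)) (T.horoIndex ω v u)]
  congr 1
  · rw [T.horoIndex_adj ω h]
    split_ifs
    · exact (zpow_one _).symm
    · exact (zpow_neg_one _).symm
  · congr 1
    ext n
    show T.param u (ω, n) ∈ s ↔ T.param v (ω, n + T.horoIndex ω v u) ∈ s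
    rw [T.param_adj h]

theorem horoMeasureAt_eq (v u : X) : T.horoMeasureAt u = T.horoMeasureAt v := by
  obtain ⟨p⟩ := T.isTree.1 v u
  induction p with
  | nil => rfl
  | cons h p ih => rw [ih, T.horoMeasureAt_adj h]

/-- The measure `λ` on the set of horocycles. It does not depend on the choice of the vertex. -/
noncomputable def horoMeasure : Measure T.Horocycles :=
  T.horoMeasureAt T.isTree.1.nonempty.some

theorem horoMeasure_eq (v : X) : T.horoMeasure = T.horoMeasureAt v := T.horoMeasureAt_eq _ _

end horocycles

section transforms

open Classical in
/-- The horocyclic Radon transform `𝓡 f (ξ) = ∑ x ∈ ξ, f x` of a finitely supported function. -/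
noncomputable def radon (f : X →₀ ℂ) (ξ : T.Horocycles) : ℂ := ∑ x ∈ f.support with x ∈ ξ.1, f x

variable [hq : Fact (2 ≤ q)]

/-- The period `T = 2π / log q`; the torus `𝕋 = ℝ / Tℤ` is `AddCircle (period q)`, with the
normalized Lebesgue measure `AddCircle.haarAddCircle`. -/
noncomputable def period (q : ℕ) : ℝ := 2 * Real.pi / Real.log q

instance : Fact (0 < period q) :=
  ⟨div_pos Real.two_pi_pos (Real.log_pos (by exact_mod_cast hq.out))⟩

/-- The function `t ↦ q ^ ((1 / 2 + i t) k)` on `𝕋`, for an integer `k`; `fourier k` is the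
function `t ↦ q ^ (i k t)`. -/
noncomputable def qPow (k : ℤ) (t : AddCircle (period q)) : ℂ :=
  ((q : ℝ) ^ ((k : ℝ) / 2) : ℝ) * fourier k t

theorem fourier_coe_eq (k : ℤ) (t : ℝ) :
    fourier k (t : AddCircle (period q)) = (q : ℂ) ^ (Complex.I * k * t) := by
  have h1 : (1 : ℝ) < q := by exact_mod_cast hq.out
  have h2 : (q : ℂ) ≠ 0 := by
    have := hq.out
    simp
    omega
  have h3 : (Real.log q : ℂ) ≠ 0 := by exact_mod_cast (Real.log_pos h1).ne'
  have h4 : (Real.pi : ℂ) ≠ 0 := by exact_mod_cast Real.pi_ne_zero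
  rw [fourier_coe_apply, Complex.cpow_def_of_ne_zero h2, period, ← Complex.natCast_log]
  congr 1
  push_cast
  field_simp

theorem qPow_coe_eq (k : ℤ) (t : ℝ) :
    qPow k (t : AddCircle (period q)) = (q : ℂ) ^ ((1 / 2 + Complex.I * t) * k) := by
  have h2 : (q : ℂ) ≠ 0 := by
    have := hq.out
    simp
    omega
  rw [qPow, fourier_coe_eq, Complex.ofReal_cpow (by positivity), add_mul, Complex.cpow_add _ _ h2]
  push_cast
  congr 2 <;> ring

/-- The measure `ν^v ⊗ dn` on `Ω × ℤ`. -/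
noncomputable abbrev timeMeasure (v : X) : Measure (T.Boundary × ℤ) :=
  (T.boundaryMeasure v).prod Measure.count

/-- The measure `ν^v ⊗ dt` on `Ω × 𝕋`. -/
noncomputable abbrev frequencyMeasure (v : X) : Measure (T.Boundary × AddCircle (period q)) :=
  (T.boundaryMeasure v).prod AddCircle.haarAddCircle

variable {T} in
theorem memLp_pullback (v : X) (F : Lp ℂ 2 T.horoMeasure) :
    MemLp (fun p : T.Boundary × ℤ => (((q : ℝ) ^ ((p.2 : ℝ) / 2) : ℝ) : ℂ) * F (T.param v p)) 2
      (T.timeMeasure v) := by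
  have hF := Lp.memLp F
  have h1 : MemLp (fun p => F (T.param v p)) 2
      ((T.timeMeasure v).withDensity fun p => (q : ℝ≥0∞) ^ p.2) := by
    rw [← prod_withDensity_right (by fun_prop : Measurable fun n : ℤ => (q : ℝ≥0∞) ^ n)]
    refine hF.comp_measurePreserving ⟨T.measurable_param v, ?_⟩
    rw [T.horoMeasure_eq v]
    rfl
  have hm : Measurable fun p : T.Boundary × ℤ => (q : ℝ≥0∞) ^ p.2 :=
    (by fun_prop : Measurable fun n : ℤ => (q : ℝ≥0∞) ^ n).comp measurable_snd
  have hsm := (Lp.stronglyMeasurable F).measurable.comp (T.measurable_param v)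
  refine ⟨Measurable.aestronglyMeasurable (Measurable.mul ?_ hsm), ?_⟩
  · exact (by fun_prop : Measurable fun n : ℤ => (((q : ℝ) ^ ((n : ℝ) / 2) : ℝ) : ℂ)).comp
      measurable_snd
  have h2 := h1.2
  rw [eLpNorm_lt_top_iff_lintegral_rpow_enorm_lt_top (by simp) (by simp)] at h2 ⊢
  rw [lintegral_withDensity_eq_lintegral_mul_non_measurable _ hm
    (Filter.Eventually.of_forall fun p => ENNReal.zpow_lt_top q_ne_zero (by simp) _)] at h2
  refine lt_of_eq_of_lt (lintegral_congr fun p => ?_) h2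
  have hq1 : (0 : ℝ) < q := by
    have := hq.out
    exact_mod_cast (by omega : 0 < q)
  rw [Pi.mul_apply, enorm_mul, ENNReal.mul_rpow_of_nonneg _ _ (by simp)]
  congr 1
  rw [← ofReal_norm, Complex.norm_real, Real.norm_of_nonneg (by positivity),
    ENNReal.ofReal_rpow_of_nonneg (by positivity) (by simp), ← Real.rpow_mul hq1.le]
  simp only [ENNReal.toReal_ofNat, div_mul_cancel_of_invertible]
  rw [← ENNReal.ofReal_rpow_of_pos hq1, ENNReal.rpow_intCast, ENNReal.ofReal_natCast]

/-- The pull-back `Ψ_v^*` from `L²(Ξ)` to `L²(Ω × ℤ)`: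
`Ψ_v^* F (ω, n) = q ^ (n / 2) F (h_{ω,n}^v)`. -/
noncomputable def pullback (v : X) (F : Lp ℂ 2 T.horoMeasure) : Lp ℂ 2 (T.timeMeasure v) :=
  (memLp_pullback v F).toLp _

variable {T} in
theorem memLp_fourierTerm (v : X) (φ : Lp ℂ 2 (T.timeMeasure v)) (n : ℤ) :
    MemLp (fun p : T.Boundary × AddCircle (period q) => φ (p.1, n) * fourier n p.2) 2
      (T.frequencyMeasure v) := by
  have h1 : MemLp (fun ω => φ (ω, n)) 2 (T.boundaryMeasure v) := by
    have h2 : (T.boundaryMeasure v).prod (Measure.dirac n) ≤ T.timeMeasure v :=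
      Measure.prod_mono le_rfl <| Measure.le_iff.2 fun s _ => by
        by_cases h : n ∈ s
        · rw [Measure.dirac_apply_of_mem h, ← Measure.count_singleton n]
          exact measure_mono (Set.singleton_subset_iff.2 h)
        · simp [h]
    have h3 := (Lp.memLp φ).mono_measure h2
    refine h3.comp_measurePreserving (f := fun ω => (ω, n)) ⟨by fun_prop, ?_⟩
    rw [Measure.prod_dirac]
  have h4 := h1.comp_fst (AddCircle.haarAddCircle : Measure (AddCircle (period q)))
  refine h4.of_le (h4.1.mul (Continuous.aestronglyMeasurable (by fun_prop))) ?_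
  refine Filter.Eventually.of_forall fun p => ?_
  rw [norm_mul, fourier_apply, Circle.norm_coe, mul_one]

/-- The Fourier transform `I ⊗ 𝓕` in the second variable, from `L²(Ω × ℤ)` to `L²(Ω × 𝕋)`: the
sum in `L²(Ω × 𝕋)` of the functions `φ(ω, n) q ^ (i n t)` over all integers `n`. These are pairwise
orthogonal and the squares of their norms add up to `‖φ‖²`, so that the series converges. -/
noncomputable def fourierTransform (v : X) (φ : Lp ℂ 2 (T.timeMeasure v)) :
    Lp ℂ 2 (T.frequencyMeasure v) :=
  ∑' n : ℤ, (memLp_fourierTerm v φ n).toLp _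

/-- The operator `Φ_v = (I ⊗ 𝓕) Ψ_v^*` from `L²(Ξ)` to `L²(Ω × 𝕋)`. -/
noncomputable def Phi (v : X) (F : Lp ℂ 2 T.horoMeasure) : Lp ℂ 2 (T.frequencyMeasure v) :=
  T.fourierTransform v (T.pullback v F)

/-- The space `L²_♭(Ξ)`: for every `v`, the integral of `Φ_v F (·, t)` with respect to `ν^v` is an
even function of `t`, up to null sets. -/
def flatL2 : Set (Lp ℂ 2 T.horoMeasure) :=
  {F | ∀ v : X, ∀ᵐ t ∂(AddCircle.haarAddCircle : Measure (AddCircle (period q))),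
    ∫ ω, T.Phi v F (ω, t) ∂T.boundaryMeasure v = ∫ ω, T.Phi v F (ω, -t) ∂T.boundaryMeasure v}

/-- The Helgason-Fourier transform `𝓗_v f (ω, t) = ∑ x, f x q ^ ((1 / 2 + i t) κ_ω(v, x))` of a
finitely supported function. -/
noncomputable def helgason (v : X) (f : X →₀ ℂ) (p : T.Boundary × AddCircle (period q)) : ℂ :=
  ∑ x ∈ f.support, f x * qPow (T.horoIndex p.1 v x) p.2

end transforms

end HomogeneousTree

/-! Fix `ω` and `v`. Every vertex `x` lies on exactly one horocycle `h^v_{ω,n}`, the one with `n =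
κ_ω(v, x)`. So multiplying `𝓡 f(h^v_{ω,n})` by `q ^ (n / 2) q ^ (i n t)` and summing over `n` merely
groups the sum defining `𝓗_v f` by the value of `κ` (`sum_fourier_radon`). Since `|κ_ω(v, x)| ≤ d(v,
x)` and `f` has finite support, only finitely many `n` occur, uniformly in `ω`. The `L²` series for
`Φ_v` is thus a finite sum, and what remains is to match almost everywhere representatives
(`Phi_radon`). Square integrability of `𝓡 f` holds because the horocycles through a given vertex
form a set of measure `1`.

Flatness is the evenness in `t` of the spherical functions `∫ q ^ ((1/2 + it) κ_ω(v, x)) dν^v`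
(`integral_qPow_neg`), which combines three facts: the law of `κ_ω(v, x)` under `ν^v` depends on
`d(v, x)` only, so `v` and `x` may be exchanged; `dν^x / dν^v = q ^ κ_ω(v, x)`; and `κ_ω(x, v) =
-κ_ω(v, x)`. With `κ = κ_ω(v, x)` they give `∫ q ^ ((1/2 - it) κ) dν^v = ∫ q ^ (-(1/2 - it) κ) dν^x
= ∫ q ^ (κ - (1/2 - it) κ) dν^v`, and the last exponent is `(1/2 + it) κ`. -/

theorem MeasureTheory.MemLp.toLp_finsetSum {α ι E : Type*} [MeasurableSpace α]
    {μ : Measure α} [NormedAddCommGroup E] {p : ℝ≥0∞} {g : ι → α → E}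
    (hg : ∀ i, MemLp (g i) p μ) (s : Finset ι) :
    ∑ i ∈ s, (hg i).toLp (g i) =
      (memLp_finsetSum s fun i _ => hg i).toLp (fun a => ∑ i ∈ s, g i a) := by
  classical
  induction s using Finset.induction_on with
  | empty =>
    simp only [Finset.sum_empty]
    exact (MemLp.toLp_zero _).symm
  | insert i s hi ih =>
    rw [Finset.sum_insert hi, ih, ← MemLp.toLp_add]
    refine MemLp.toLp_congr _ _ (Filter.Eventually.of_forall fun a => ?_)
    exact (Finset.sum_insert (f := fun i => g i a) hi).symm

namespace HomogeneousTree

variable {X : Type*} {q : ℕ} (T : HomogeneousTree X q)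

/-! ### The horocyclic index as a bounded measurable cocycle -/

section horoIndexCocycle

/-- The cocycle identity for one edge propagates along any walk from `v` to `u`; the three vertices
need not lie on a common path. -/
theorem horoIndex_add (ω : T.Boundary) (v u x : X) :
    T.horoIndex ω v x = T.horoIndex ω v u + T.horoIndex ω u x := by
  obtain ⟨p⟩ := T.isTree.1 v u
  induction p with
  | nil => rw [horoIndex_self, zero_add]
  | @cons a b c h p ih => rw [T.horoIndex_add_adj ω h x, T.horoIndex_add_adj ω h c, ih, add_assoc]

theorem horoIndex_symm (ω : T.Boundary) (v u : X) :
    T.horoIndex ω u v = - T.horoIndex ω v u := by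
  have h := T.horoIndex_add ω v u v
  rw [horoIndex_self] at h
  omega

theorem measurable_horoIndex (v x : X) : Measurable fun ω : T.Boundary => T.horoIndex ω v x := by
  classical
  obtain ⟨p⟩ := T.isTree.1 v x
  induction p with
  | nil => simp only [horoIndex_self, measurable_const]
  | @cons a b c h p ih =>
    simp only [T.horoIndex_add_adj _ h c, T.horoIndex_adj _ h]
    exact (Measurable.ite (measurableSet_shadow _ _) measurable_const measurable_const).add ih

theorem measurable_zpow_horoIndex (v x : X) :
    Measurable fun ω : T.Boundary => (q : ℝ≥0∞) ^ T.horoIndex ω v x :=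
  (measurable_of_countable fun k : ℤ => (q : ℝ≥0∞) ^ k).comp (T.measurable_horoIndex v x)

/-- Each of the `d(v, x)` steps contributes `±1`. The bound is uniform in `ω`, which later makes
functions of `κ` integrable and the Fourier series finite. -/
theorem abs_horoIndex_le (ω : T.Boundary) (v x : X) : |T.horoIndex ω v x| ≤ T.d v x := by
  classical
  rw [← path_length, horoIndex]
  induction T.path v x with
  | nil => simp
  | cons h p ih =>
    rw [SimpleGraph.Walk.darts_cons, List.map_cons, List.sum_cons, SimpleGraph.Walk.length_cons]
    refine (abs_add_le _ _).trans ?_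
    push_cast
    rw [add_comm]
    refine add_le_add ih ?_
    split_ifs <;> simp

theorem Chain.horoIndex_eq {T : HomogeneousTree X q} (c : T.Chain) (m : ℕ) :
    T.horoIndex c.toBoundary (c.1 0) (c.1 m) = m := by
  classical
  induction m with
  | zero => exact T.horoIndex_self _ _
  | succ m ih =>
    rw [T.horoIndex_add _ _ (c.1 m), ih, T.horoIndex_adj _ (c.adj m), if_pos]
    · push_cast
      rfl
    · exact ⟨c.drop m, c.toBoundary_drop m, rfl, 1, rfl⟩

theorem horoIndex_of_mem_shadow {ω : T.Boundary} {v x : X} (h : ω ∈ T.shadow v x) :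
    T.horoIndex ω v x = T.d v x := by
  obtain ⟨c, rfl, rfl, m, rfl⟩ := h
  rw [c.horoIndex_eq, c.d_start]

/-- Whether `[v, ω)` passes through `x` is decided on the last edge of `[v, x]`: the starting vertex
can be moved along the path up to `y` without changing the shadow of `x`. -/
theorem shadow_parent {v x y : X} (h : T.graph.Adj y x) (hd : T.d v x = T.d v y + 1) :
    T.shadow v x = T.shadow y x := by
  obtain ⟨n, hn⟩ : ∃ n, T.d v y = n := ⟨_, rfl⟩
  induction n generalizing v with
  | zero => rw [T.d_eq_zero.1 hn]
  | succ n ih =>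
    obtain ⟨u, hu, hyu⟩ := T.exists_parent (v := y) (x := v) (by
      rintro rfl
      rw [d_self] at hn
      omega)
    -- Comparing `d(u, x)` with both `d(v, x) = n + 2` and `d(u, y) = n` leaves only `n + 1`, so `u`
    -- is also one step closer to `x`.
    have h1 := T.d_adj x hu
    have h2 := T.d_adj u h
    rw [T.d_comm x u, T.d_comm x v] at h1
    rw [T.d_comm y u, T.d_comm y v] at hyu
    have hux : T.d u x = n + 1 := by omega
    rw [T.shadow_eq hu.symm (by omega), ih (by omega) (by omega)]
    rintro rfl
    rw [d_self] at hux
    omega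

variable {T} in
/-- Peeling off the last step of the path `[v, x]`. -/
theorem apply_horoIndex_parent (g : ℤ → ℂ) {v x y : X} (h : T.graph.Adj y x)
    (hd : T.d v x = T.d v y + 1) (ω : T.Boundary) :
    g (T.horoIndex ω v x) = g (T.horoIndex ω v y - 1) +
      (T.shadow v x).indicator (fun _ => g (T.d v x) - g (T.d v x - 2)) ω := by
  classical
  have h1 := T.horoIndex_add ω v y x
  rw [T.horoIndex_adj ω h, ← T.shadow_parent h hd] at h1
  -- On the shadow all steps count `+1`, so `κ_ω(v, x) = d(v, x)` and `κ_ω(v, y) - 1 = d(v, x) - 2`;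
  -- off it the last step counts `-1` and no correction is needed.
  by_cases hω : ω ∈ T.shadow v x
  · rw [if_pos hω, T.horoIndex_of_mem_shadow hω] at h1
    rw [Set.indicator_of_mem hω, T.horoIndex_of_mem_shadow hω,
      show T.horoIndex ω v y - 1 = T.d v x - 2 by omega]
    ring
  · rw [if_neg hω] at h1
    rw [Set.indicator_of_notMem hω, add_zero, h1, sub_eq_add_neg]

end horoIndexCocycle

/-! ### Integrals over the boundary and evenness of the spherical functions -/

section boundaryIntegrals

variable [hq : Fact (2 ≤ q)]

theorem integrable_apply_horoIndex (g : ℤ → ℂ) (w v x : X) :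
    Integrable (fun ω => g (T.horoIndex ω v x)) (T.boundaryMeasure w) := by
  -- Only the values of `g` at the finitely many possible indices matter; the sum of their norms is
  -- a crude bound.
  refine Integrable.of_bound (C := ∑ k ∈ Finset.Icc (-(T.d v x : ℤ)) (T.d v x), ‖g k‖)
    (((measurable_of_countable g).comp (T.measurable_horoIndex v x)).aestronglyMeasurable)
    (Filter.Eventually.of_forall fun ω => ?_)
  exact Finset.single_le_sum (f := fun k => ‖g k‖) (fun _ _ => norm_nonneg _)
    (Finset.mem_Icc.2 (abs_le.1 (T.abs_horoIndex_le ω v x)))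

/-- The law of `κ_ω(v, x)` with respect to `ν^v` depends on the distance of `v` and `x` only. -/
theorem integral_apply_horoIndex_congr {v x v' x' : X} (hd : T.d v x = T.d v' x') (g : ℤ → ℂ) :
    ∫ ω, g (T.horoIndex ω v x) ∂T.boundaryMeasure v =
      ∫ ω, g (T.horoIndex ω v' x') ∂T.boundaryMeasure v' := by
  obtain ⟨n, hn⟩ : ∃ n, T.d v x = n := ⟨_, rfl⟩
  -- The function `g` has to vary, since removing the last step of the path replaces it by `k ↦ g (k
  -- - 1)`.
  induction n generalizing x x' g with
  | zero =>
    obtain rfl := T.d_eq_zero.1 hn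
    obtain rfl := T.d_eq_zero.1 (hd.symm.trans hn)
    simp only [horoIndex_self, integral_const, probReal_univ]
  | succ n ih =>
    -- The correction term is a constant times the mass of the shadow of `x`, and both depend on `n`
    -- only. No isometry exchanging pairs of vertices is needed.
    have step : ∀ {v x : X}, T.d v x = n + 1 → ∃ y, T.d v y = n ∧
        ∫ ω, g (T.horoIndex ω v x) ∂T.boundaryMeasure v =
          ∫ ω, g (T.horoIndex ω v y - 1) ∂T.boundaryMeasure v +
            ((q + 1 : ℝ≥0∞) * q ^ n)⁻¹.toReal • (g (n + 1 : ℕ) - g ((n + 1 : ℕ) - 2)) := by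
      intro v x hn
      have hx : x ≠ v := by
        rintro rfl
        rw [d_self] at hn
        omega
      obtain ⟨y, hy, hd⟩ := T.exists_parent hx
      refine ⟨y, by omega, ?_⟩
      rw [integral_congr_ae (Filter.Eventually.of_forall (apply_horoIndex_parent g hy hd)),
        integral_add (T.integrable_apply_horoIndex (fun k => g (k - 1)) v v y)
          ((integrable_const _).indicator (measurableSet_shadow v x)),
        integral_indicator (measurableSet_shadow v x), setIntegral_const, measureReal_def,
        T.boundaryMeasure_shadow v hx, hn, Nat.add_sub_cancel]
    obtain ⟨y, hy, h1⟩ := step hn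
    obtain ⟨y', hy', h2⟩ := step (hd.symm.trans hn)
    rw [h1, h2, ih (hy.trans hy'.symm) (fun k => g (k - 1)) hy]

/-- The density of `ν^u` with respect to `ν^v` is `q ^ κ_ω(v, u)`. -/
theorem boundaryMeasure_eq_withDensity (v u : X) :
    T.boundaryMeasure u =
      (T.boundaryMeasure v).withDensity fun ω => (q : ℝ≥0∞) ^ T.horoIndex ω v u := by
  classical
  obtain ⟨p⟩ := T.isTree.1 v u
  induction p with
  | nil =>
    simp only [horoIndex_self, zpow_zero]
    exact withDensity_one.symm
  | @cons a b c h p ih =>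
    have hb : T.boundaryMeasure b =
        (T.boundaryMeasure a).withDensity fun ω => (q : ℝ≥0∞) ^ T.horoIndex ω a b := by
      rw [T.boundaryMeasure_adj h]
      congr 1
      ext ω
      rw [T.horoIndex_adj ω h]
      split_ifs
      · exact (zpow_one _).symm
      · exact (zpow_neg_one _).symm
    -- Densities multiply along the walk, and the cocycle identity turns the product into a single
    -- power of `q`.
    rw [ih, hb, ← withDensity_mul _ (T.measurable_zpow_horoIndex a b)
      (T.measurable_zpow_horoIndex b c)]
    congr 1
    ext ω
    rw [T.horoIndex_add ω a b c, ENNReal.zpow_add q_ne_zero (by simp), Pi.mul_apply]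

/-- The two signs cancel in the character, and `k - k / 2 = k / 2` in the modulus. This is the
effect of the density on the integrand when the base vertex changes. -/
theorem zpow_smul_qPow_neg (k : ℤ) (t : AddCircle (period q)) :
    ((q : ℝ≥0∞) ^ k).toReal • qPow (-k) (-t) = qPow k t := by
  have hq0 : (0 : ℝ) < q := by exact_mod_cast (zero_lt_two.trans_le hq.out)
  have h1 : (fourier (-k) (-t) : ℂ) = fourier k t := by
    rw [fourier_apply, fourier_apply, neg_smul_neg]
  rw [qPow, qPow, h1, Complex.real_smul, ← mul_assoc, ← Complex.ofReal_mul, ← ENNReal.rpow_intCast,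
    ← ENNReal.toReal_rpow, ENNReal.toReal_natCast, ← Real.rpow_add hq0]
  congr 4
  push_cast
  ring

/-- The spherical functions are even in the spectral parameter. -/
theorem integral_qPow_neg (v x : X) (t : AddCircle (period q)) :
    ∫ ω, qPow (T.horoIndex ω v x) (-t) ∂T.boundaryMeasure v =
      ∫ ω, qPow (T.horoIndex ω v x) t ∂T.boundaryMeasure v := by
  -- Exchange `v` and `x` on the left-hand side, then return from `ν^x` to `ν^v` at the cost of the
  -- density.
  rw [T.integral_apply_horoIndex_congr (T.d_comm v x) fun k => qPow k (-t),
    T.boundaryMeasure_eq_withDensity v x, integral_withDensity_eq_integral_toReal_smul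
      (T.measurable_zpow_horoIndex v x)
      (Filter.Eventually.of_forall fun ω => ENNReal.zpow_lt_top q_ne_zero (by simp) _)]
  refine integral_congr_ae (Filter.Eventually.of_forall fun ω => ?_)
  show ((q : ℝ≥0∞) ^ T.horoIndex ω v x).toReal • qPow (T.horoIndex ω x v) (-t) = _
  rw [T.horoIndex_symm ω v x, zpow_smul_qPow_neg]

theorem integral_helgason_neg (v : X) (f : X →₀ ℂ) (t : AddCircle (period q)) :
    ∫ ω, T.helgason v f (ω, -t) ∂T.boundaryMeasure v =
      ∫ ω, T.helgason v f (ω, t) ∂T.boundaryMeasure v := by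
  have h : ∀ t, ∫ ω, T.helgason v f (ω, t) ∂T.boundaryMeasure v =
      ∑ x ∈ f.support, f x * ∫ ω, qPow (T.horoIndex ω v x) t ∂T.boundaryMeasure v := by
    intro t
    simp only [helgason]
    rw [integral_finsetSum _ fun x _ =>
      (T.integrable_apply_horoIndex (fun k => qPow k t) v v x).const_mul (f x)]
    exact Finset.sum_congr rfl fun x _ => integral_const_mul _ _
  rw [h, h]
  exact Finset.sum_congr rfl fun x _ => by rw [integral_qPow_neg]

end boundaryIntegrals

/-! ### The Radon transform: integrability, Fourier series and flatness -/

section radonTransform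

theorem measurableSet_setOf_mem_horocycle (x : X) :
    MeasurableSet {ξ : T.Horocycles | x ∈ ξ.1} := by
  -- Measurability for the infimum `σ`-algebra has to be checked in every parametrization.
  refine MeasurableSpace.measurableSet_iInf.2 fun v => ?_
  show MeasurableSet {p : T.Boundary × ℤ | T.horoIndex p.1 v x = p.2}
  exact measurableSet_eq_fun ((T.measurable_horoIndex v x).comp measurable_fst) measurable_snd

theorem radon_eq_sum_indicator (f : X →₀ ℂ) :
    T.radon f = fun ξ => ∑ x ∈ f.support, {ξ : T.Horocycles | x ∈ ξ.1}.indicator (fun _ => f x) ξ := by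
  classical
  ext ξ
  rw [radon, Finset.sum_filter]
  refine Finset.sum_congr rfl fun x _ => ?_
  rw [Set.indicator_apply]
  rfl

theorem radon_param_eq_zero (v : X) (f : X →₀ ℂ) {N : Finset ℤ}
    (hN : ∀ ω, ∀ x ∈ f.support, T.horoIndex ω v x ∈ N) {n : ℤ} (hn : n ∉ N) (ω : T.Boundary) :
    T.radon f (T.param v (ω, n)) = 0 := by
  classical
  rw [radon, Finset.filter_false_of_mem, Finset.sum_empty]
  intro x hx h
  have h' : T.horoIndex ω v x = n := h
  exact hn (h' ▸ hN ω x hx)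

theorem exists_finset_horoIndex_mem (v : X) (s : Finset X) :
    ∃ N : Finset ℤ, ∀ (ω : T.Boundary), ∀ x ∈ s, T.horoIndex ω v x ∈ N := by
  classical
  refine ⟨s.biUnion fun x => Finset.Icc (-(T.d v x : ℤ)) (T.d v x), fun ω x hx => ?_⟩
  exact Finset.mem_biUnion.2 ⟨x, hx, Finset.mem_Icc.2 (abs_le.1 (T.abs_horoIndex_le ω v x))⟩

/-- After exchanging the two sums, each `x` contributes for the single index `n = κ_ω(v, x)`, which
`N` contains. This is the pointwise form of `Φ_v 𝓡 f = 𝓗_v f`. -/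
theorem sum_fourier_radon (v : X) (f : X →₀ ℂ) {N : Finset ℤ}
    (hN : ∀ ω, ∀ x ∈ f.support, T.horoIndex ω v x ∈ N) (p : T.Boundary × AddCircle (period q)) :
    ∑ n ∈ N, (((q : ℝ) ^ ((n : ℝ) / 2) : ℝ) : ℂ) * T.radon f (T.param v (p.1, n)) * fourier n p.2 =
      T.helgason v f p := by
  classical
  have h : ∀ n, T.radon f (T.param v (p.1, n)) =
      ∑ x ∈ f.support, if T.horoIndex p.1 v x = n then f x else 0 := by
    intro n
    rw [radon, Finset.sum_filter]
    exact Finset.sum_congr rfl fun x _ => if_congr Iff.rfl rfl rfl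
  simp only [h, Finset.mul_sum, Finset.sum_mul]
  rw [Finset.sum_comm, helgason]
  refine Finset.sum_congr rfl fun x hx => ?_
  rw [Finset.sum_eq_single_of_mem _ (hN p.1 x hx) fun n _ hn => by rw [if_neg hn.symm]; simp,
    if_pos rfl, qPow]
  ring

variable [hq : Fact (2 ≤ q)]

/-- Because `λ` may be computed from any reference vertex, take `x` itself: the set becomes `Ω ×
{0}`, of mass `q ^ 0`. -/
theorem horoMeasure_setOf_mem (x : X) : T.horoMeasure {ξ | x ∈ ξ.1} = 1 := by
  rw [T.horoMeasure_eq x, horoMeasureAt,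
    Measure.map_apply (T.measurable_param x) (T.measurableSet_setOf_mem_horocycle x)]
  have : T.param x ⁻¹' {ξ | x ∈ ξ.1} = Set.univ ×ˢ {0} := by
    ext ⟨ω, n⟩
    have : (ω, n) ∈ T.param x ⁻¹' {ξ | x ∈ ξ.1} ↔ T.horoIndex ω x x = n := Iff.rfl
    rw [this, horoIndex_self]
    simp [eq_comm]
  rw [this, Measure.prod_prod, measure_univ, one_mul, weight_apply, tsum_eq_single 0]
  · simp
  · intro n hn
    simp [hn]

theorem memLp_radon (f : X →₀ ℂ) (p : ℝ≥0∞) : MemLp (T.radon f) p T.horoMeasure := by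
  rw [radon_eq_sum_indicator]
  refine memLp_finsetSum _ fun x _ => memLp_indicator_const p
    (T.measurableSet_setOf_mem_horocycle x) (f x) (Or.inr ?_)
  rw [horoMeasure_setOf_mem]
  exact ENNReal.one_ne_top

/-- The density `q ^ n` never vanishes, so counting measure is absolutely continuous with respect to
`q ^ n dn`. Hence identities valid `λ`-almost everywhere pull back to `Ω × ℤ`. -/
theorem quasiMeasurePreserving_param (v : X) :
    Measure.QuasiMeasurePreserving (T.param v) (T.timeMeasure v) T.horoMeasure := by
  refine ⟨T.measurable_param v, ?_⟩
  rw [T.horoMeasure_eq v, horoMeasureAt]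
  refine Measure.AbsolutelyContinuous.map ?_ (T.measurable_param v)
  refine Measure.AbsolutelyContinuous.rfl.prod (withDensity_absolutelyContinuous'
    (measurable_of_countable _).aemeasurable (Filter.Eventually.of_forall fun n => ?_))
  exact (ENNReal.zpow_pos q_ne_zero (by simp) n).ne'

theorem ae_pullback_radon (v : X) (f : X →₀ ℂ) (n : ℤ) :
    ∀ᵐ ω ∂T.boundaryMeasure v, T.pullback v ((T.memLp_radon f 2).toLp _) (ω, n) =
      (((q : ℝ) ^ ((n : ℝ) / 2) : ℝ) : ℂ) * T.radon f (T.param v (ω, n)) := by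
  have h1 : ∀ᵐ p ∂T.timeMeasure v, T.pullback v ((T.memLp_radon f 2).toLp _) p =
      (((q : ℝ) ^ ((p.2 : ℝ) / 2) : ℝ) : ℂ) * T.radon f (T.param v p) := by
    filter_upwards [(memLp_pullback v ((T.memLp_radon f 2).toLp _)).coeFn_toLp,
      (T.quasiMeasurePreserving_param v).ae (T.memLp_radon f 2).coeFn_toLp] with p hp hp'
    rw [pullback, hp, hp']
  -- The swap makes `n` the outer variable; almost everywhere for counting measure then means for
  -- every `n`.
  have h2 := Measure.ae_ae_of_ae_prod (Measure.measurePreserving_swap.quasiMeasurePreserving.ae h1)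
  exact Measure.ae_count_iff.1 h2 n

theorem Phi_radon (v : X) (f : X →₀ ℂ) : ∃ hH : MemLp (T.helgason v f) 2 (T.frequencyMeasure v),
    T.Phi v ((T.memLp_radon f 2).toLp (T.radon f)) = hH.toLp (T.helgason v f) := by
  obtain ⟨N, hN⟩ := T.exists_finset_horoIndex_mem v f.support
  set φ := T.pullback v ((T.memLp_radon f 2).toLp (T.radon f)) with hφ
  have hterm : ∀ n : ℤ, ∀ᵐ p ∂T.frequencyMeasure v, φ (p.1, n) * fourier n p.2 =
      (((q : ℝ) ^ ((n : ℝ) / 2) : ℝ) : ℂ) * T.radon f (T.param v (p.1, n)) * fourier n p.2 := by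
    intro n
    filter_upwards [Measure.quasiMeasurePreserving_fst.ae (T.ae_pullback_radon v f n)] with p hp
    rw [hφ, hp]
  have hsum : (fun p => ∑ n ∈ N, φ (p.1, n) * fourier n p.2) =ᵐ[T.frequencyMeasure v]
      T.helgason v f := by
    filter_upwards [ae_all_iff.2 hterm] with p hp
    rw [← T.sum_fourier_radon v f hN p]
    exact Finset.sum_congr rfl fun n _ => hp n
  have hmem := memLp_finsetSum N fun n _ => memLp_fourierTerm v φ n
  refine ⟨hmem.ae_eq hsum, ?_⟩
  -- The terms with `n ∉ N` are zero in `L²`, so the series reduces to a finite sum and its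
  -- convergence is not an issue.
  rw [Phi, ← hφ, fourierTransform, tsum_eq_sum (s := N),
    MemLp.toLp_finsetSum (memLp_fourierTerm v φ)]
  · exact MemLp.toLp_congr _ _ hsum
  · intro n hn
    rw [← MemLp.toLp_zero (MemLp.zero' (ε := ℂ))]
    refine MemLp.toLp_congr _ _ ?_
    filter_upwards [hterm n] with p hp
    rw [hp, T.radon_param_eq_zero v f hN hn, mul_zero, zero_mul]
    rfl

theorem radon_mem_flatL2 (f : X →₀ ℂ) : (T.memLp_radon f 2).toLp (T.radon f) ∈ T.flatL2 := by
  intro v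
  obtain ⟨hH, h⟩ := T.Phi_radon v f
  rw [h]
  -- The `L²` class can be replaced by the actual function inside the integral for almost every `t`.
  -- This is used at `t` and, as negation preserves Haar measure, also at `-t`.
  have h1 : ∀ᵐ t ∂(AddCircle.haarAddCircle : Measure (AddCircle (period q))),
      ∫ ω, hH.toLp (T.helgason v f) (ω, t) ∂T.boundaryMeasure v =
        ∫ ω, T.helgason v f (ω, t) ∂T.boundaryMeasure v := by
    have h2 := Measure.ae_ae_of_ae_prod
      (Measure.measurePreserving_swap.quasiMeasurePreserving.ae hH.coeFn_toLp)
    filter_upwards [h2] with t ht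
    exact integral_congr_ae ht
  filter_upwards [h1, (Measure.measurePreserving_neg
    (AddCircle.haarAddCircle : Measure (AddCircle (period q)))).quasiMeasurePreserving.ae h1]
    with t ht ht'
  rw [ht, ht', integral_helgason_neg]

end radonTransform

end HomogeneousTree

theorem mainTheorem5 {X : Type*} {q : ℕ} [Fact (2 ≤ q)] (T : HomogeneousTree X q) (f : X →₀ ℂ) :
    ∃ hR : MemLp (T.radon f) 2 T.horoMeasure,
      (∀ v : X, ∃ hH : MemLp (T.helgason v f) 2 (T.frequencyMeasure v),
        T.Phi v (hR.toLp (T.radon f)) = hH.toLp (T.helgason v f)) ∧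
      hR.toLp (T.radon f) ∈ T.flatL2 :=
  ⟨T.memLp_radon f 2, fun v => T.Phi_radon v f, T.radon_mem_flatL2 f⟩
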